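/- Let $(\Omega,\mathcal F,\mathbb P)$ be a probability space and let $\Lambda=(\Lambda(A))$, indexed by the bounded Borel sets $A\subseteq\mathbb R_+\times\mathbb R$ (where $\mathbb R_+=[0,\infty)$), be a (not necessarily homogeneous) Lévy basis, that is, an infinitely divisible independently scattered random measure: each $\Lambda(A)$ is a real random variable with infinitely divisible law; $\Lambda(A_1),\Lambda(A_2),\dots$ are independent whenever $A_1,A_2,\dots$ are pairwise disjoint; and if moreover $\bigcup_n A_n$ is bounded, then $\Lambda(\bigcup_n A_n)=\sum_n\Lambda(A_n)$ almost surely, the series converging almost surely. Assume that $\Lambda$ has mean $0$, i.e. $\mathbb E|\Lambda(A)|<\infty$ and $\mathbb E[\Lambda(A)]=0$ for every bounded Borel set $A$. Let $c>0$. Write $(s,y)\preceq(t,x)$ if $s\le t$ and $|x-y|\le c(t-s)$, let $[(\tilde t,\tilde x),(t,x)]_\preceq$ be the set of all $(s,y)\in\mathbb R_+\times\mathbb R$ with $(\tilde t,\tilde x)\preceq(s,y)\preceq(t,x)$, and let $A^+(t,x)=\{(s,y)\in\mathbb R_+\times\mathbb R: s\le t,\ |x-y|\le c(t-s)\}$ be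 the backward light cone of $(t,x)$. Fix $(\tilde t,\tilde x)\preceq(t,x)$ in $\mathbb R_+\times\mathbb R$ and put $I=[(\tilde t,\tilde x),(t,x)]_\preceq$. The process $(s,y)\mapsto\Lambda(A^+(s,y))$ on $\mathbb R_+\times\mathbb R$ has a version $X$ that is separable on $I$ in the sense of Doob: there is a countable $D\subseteq I$ such that almost surely, for every $r\in I$ and every neighbourhood $U$ of $r$, the value $X(r)$ lies in the closure of $\{X(u):u\in D\cap U\}$. For every such version $X$ the supremum of $|X|$ over $I$ is (almost surely equal to) a random variable with values in $[0,\infty]$, and the following hold. 1. For every $\lambda>0$, $$\lambda\,\mathbb P\Big[\sup_{(s,y)\in I}|X(s,y)|\ge\lambda\Big]\le 13\,\mathbb E\big[|X(t,x)|\big].$$ 2. If $p>1$ and $\Lambda$ has a finite $p$-th moment, i.e. $\mathbb E|\Lambda(A)|^p<\infty$ for every bounded Borel set $A$, then $$\mathbb E\Big[\sup_{(s,y)\in I}|X(s,y)|^p\Big]\le\Big(\frac p{p-1}\Big)^{2p}\,\mathbb E\big[|X(t,x)|^p\big].$$ -/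

import Mathlib

open MeasureTheory ProbabilityTheory Filter Topology
open scoped NNReal ENNReal

/-- A law on `ℝ` is infinitely divisible if for every `n ≥ 1` it is the law of a sum of `n`
i.i.d. random variables, i.e. an `n`-fold convolution power of a probability measure. -/
def IsInfinitelyDivisible (m : Measure ℝ) : Prop :=
  ∀ n : ℕ, 1 ≤ n → ∃ ρ : Measure ℝ, IsProbabilityMeasure ρ ∧
    (Measure.pi (fun _ : Fin n => ρ)).map (fun x => ∑ i, x i) = m

/-- A (not necessarily homogeneous) Lévy basis on `ℝ₊ × ℝ`: an infinitely divisible independently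
scattered random measure. Only the values `Λ A` at bounded Borel sets `A` are meaningful.
The series in `sigma_additive` is only required to converge almost surely in the given order:
absolute convergence fails already for Gaussian white noise. -/
structure IsLevyBasis {Ω : Type*} [MeasurableSpace Ω]
    (Λ : Set (ℝ≥0 × ℝ) → Ω → ℝ) (P : Measure Ω) : Prop where
  measurable : ∀ A : Set (ℝ≥0 × ℝ), MeasurableSet A → Bornology.IsBounded A → Measurable (Λ A)
  indep : ∀ A : ℕ → Set (ℝ≥0 × ℝ), (∀ n, MeasurableSet (A n)) →
    (∀ n, Bornology.IsBounded (A n)) → Pairwise (Function.onFun Disjoint A) →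
    iIndepFun (fun n => Λ (A n)) P
  sigma_additive : ∀ A : ℕ → Set (ℝ≥0 × ℝ), (∀ n, MeasurableSet (A n)) →
    Bornology.IsBounded (⋃ n, A n) → Pairwise (Function.onFun Disjoint A) →
    ∀ᵐ ω ∂P, Tendsto (fun N : ℕ => ∑ n ∈ Finset.range N, Λ (A n) ω) atTop
      (𝓝 (Λ (⋃ n, A n) ω))
  infinitely_divisible : ∀ A : Set (ℝ≥0 × ℝ), MeasurableSet A → Bornology.IsBounded A →
    IsInfinitelyDivisible (P.map (Λ A))

/-- The random measure `Λ` has mean `0`. -/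
def HasMeanZero {Ω : Type*} [MeasurableSpace Ω]
    (Λ : Set (ℝ≥0 × ℝ) → Ω → ℝ) (P : Measure Ω) : Prop :=
  ∀ A : Set (ℝ≥0 × ℝ), MeasurableSet A → Bornology.IsBounded A →
    Integrable (Λ A) P ∧ ∫ ω, Λ A ω ∂P = 0

/-- The random measure `Λ` has a finite moment of order `a`. -/
def HasFiniteMoment {Ω : Type*} [MeasurableSpace Ω]
    (Λ : Set (ℝ≥0 × ℝ) → Ω → ℝ) (P : Measure Ω) (a : ℝ) : Prop :=
  ∀ A : Set (ℝ≥0 × ℝ), MeasurableSet A → Bornology.IsBounded A →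
    Integrable (fun ω => |Λ A ω| ^ a) P

/-- The partial order `(s, y) ⪯ (t, x)` on `ℝ₊ × ℝ`: `s ≤ t` and `|x - y| ≤ c (t - s)`. -/
def ConeLE (c : ℝ) (r q : ℝ≥0 × ℝ) : Prop :=
  r.1 ≤ q.1 ∧ |q.2 - r.2| ≤ c * ((q.1 : ℝ) - (r.1 : ℝ))

/-- The closed interval `[p, q]` with respect to `⪯`. -/
def coneInterval (c : ℝ) (p q : ℝ≥0 × ℝ) : Set (ℝ≥0 × ℝ) :=
  {r | ConeLE c p r ∧ ConeLE c r q}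

/-- The truncated backward light cone `A⁺(t, x) = ((t, x) - {(s, y) : s ≥ 0, |y| ≤ c s}) ∩ ℝ₊ × ℝ`. -/
def backwardCone (c : ℝ) (q : ℝ≥0 × ℝ) : Set (ℝ≥0 × ℝ) :=
  {r | 0 ≤ (q.1 : ℝ) - (r.1 : ℝ) ∧ |q.2 - r.2| ≤ c * ((q.1 : ℝ) - (r.1 : ℝ))}

/-- `Y` is a version (modification) of `X`. -/
def IsVersion {Ω T : Type*} [MeasurableSpace Ω] (Y X : T → Ω → ℝ) (P : Measure Ω) : Prop :=
  ∀ r, Y r =ᵐ[P] X r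

/-- Separability, in the sense of Doob, of the process `(Y r)`, `r ∈ I`: there is a countable
`D ⊆ I` such that, almost surely, for all `r ∈ I` the value of the path at `r` is a limit of values
at points of `D` that tend to `r`. -/
def IsSeparableOn {Ω T : Type*} [MeasurableSpace Ω] [TopologicalSpace T]
    (Y : T → Ω → ℝ) (I : Set T) (P : Measure Ω) : Prop :=
  ∃ D : Set T, D.Countable ∧ D ⊆ I ∧
    ∀ᵐ ω ∂P, ∀ r ∈ I, ∀ U ∈ 𝓝 r, Y r ω ∈ closure ((fun u => Y u ω) '' (D ∩ U))

/-!
In the characteristic coordinates `(c t + x, c t - x)` the order `⪯` is the coordinatewise order and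
the backward light cones are quadrants. The values of `Λ` at finitely many quadrants below a given
one are two-parameter partial sums of independent centred variables, one for each cell of the grid
spanned by the corners. Their maximal function is treated as by Cairoli: the maxima over the second
parameter form a submartingale in the first, to which Doob's inequalities apply. What remains is the
maximal function of a one-parameter sum. For `p > 1` it is bounded by Doob's inequality again; for
`p = 1` its mean is bounded by Ottaviani's inequality, that is, by stopping at the first large sum
and using that the later increments are independent of the past. This gives the weak-type bound with
constant `6`. Monotone limits pass from finite to countable sets of quadrants, and continuity of `Λ`
along decreasing quadrants provides a separable version.
-/
section StrongType

variable {Ω : Type*} [MeasurableSpace Ω] {P : Measure Ω}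

theorem lintegral_rpow_le_lintegral_mul_rpow_sub_one {M : Ω → ℝ} {f : Ω → ℝ≥0∞} {p : ℝ}
    (hM : Measurable M) (hM0 : 0 ≤ M) (hf : Measurable f) (hp : 1 < p)
    (hweak : ∀ t : ℝ, 0 < t → ENNReal.ofReal t * P {ω | t ≤ M ω} ≤ ∫⁻ ω in {ω | t ≤ M ω}, f ω ∂P) :
    ∫⁻ ω, ENNReal.ofReal (M ω ^ p) ∂P ≤
      ENNReal.ofReal (p / (p - 1)) * ∫⁻ ω, f ω * ENNReal.ofReal (M ω ^ (p - 1)) ∂P := by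
  have hp1 : 0 < p - 1 := by linarith
  have layer_cake (ν : Measure Ω) {r : ℝ} (hr : 0 < r) :=
    lintegral_rpow_eq_lintegral_meas_le_mul ν (Eventually.of_forall hM0) hM.aemeasurable hr
  have density : ∫⁻ ω, f ω * ENNReal.ofReal (M ω ^ (p - 1)) ∂P =
      ∫⁻ ω, ENNReal.ofReal (M ω ^ (p - 1)) ∂(P.withDensity f) :=
    (lintegral_withDensity_eq_lintegral_mul _ hf (by fun_prop)).symm
  rw [density, layer_cake P (by linarith), layer_cake _ hp1, ← mul_assoc,
    ← ENNReal.ofReal_mul (by positivity), div_mul_cancel₀ _ hp1.ne']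
  gcongr 1
  refine setLIntegral_mono' measurableSet_Ioi fun t (ht : 0 < t) => ?_
  calc P {ω | t ≤ M ω} * ENNReal.ofReal (t ^ (p - 1))
      = ENNReal.ofReal t * P {ω | t ≤ M ω} * ENNReal.ofReal (t ^ (p - 1 - 1)) := by
        rw [mul_comm (ENNReal.ofReal t), mul_assoc, ← ENNReal.ofReal_mul ht.le,
          Real.rpow_sub_one ht.ne' (p - 1), mul_div_cancel₀ _ ht.ne']
    _ ≤ P.withDensity f {ω | t ≤ M ω} * ENNReal.ofReal (t ^ (p - 1 - 1)) := by
        rw [withDensity_apply _ (measurableSet_le measurable_const hM)]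
        gcongr
        exact hweak t ht

theorem le_rpow_mul_of_le_mul_rpow_one_div {A B C : ℝ≥0∞} {p : ℝ} (hp : 1 < p) (hA : A ≠ ∞)
    (h : A ≤ C * (B ^ (1 / p) * A ^ (1 / (p / (p - 1))))) : A ≤ C ^ p * B := by
  have : 0 < p - 1 := by linarith
  have hp0 : 0 < p := by linarith
  rcases eq_or_ne A 0 with rfl | hA0
  · exact zero_le
  have hroot : A ^ (1 / p) ≤ C * B ^ (1 / p) := by
    have hpos : A ^ (1 / (p / (p - 1))) ≠ 0 := by simp [ENNReal.rpow_eq_zero_iff, hA0, hA]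
    have hfin : A ^ (1 / (p / (p - 1))) ≠ ∞ := ENNReal.rpow_ne_top_of_nonneg (by positivity) hA
    have hexp : 1 / p + 1 / (p / (p - 1)) = 1 := by field_simp; ring
    rwa [← ENNReal.mul_le_mul_iff_left hpos hfin, ← ENNReal.rpow_add _ _ hA0 hA, hexp,
      ENNReal.rpow_one, mul_assoc]
  calc A = (A ^ (1 / p)) ^ p := by
        rw [← ENNReal.rpow_mul, one_div_mul_cancel hp0.ne', ENNReal.rpow_one]
    _ ≤ (C * B ^ (1 / p)) ^ p := by gcongr
    _ = C ^ p * B := by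
      rw [ENNReal.mul_rpow_of_nonneg _ _ hp0.le, ← ENNReal.rpow_mul, one_div_mul_cancel hp0.ne',
        ENNReal.rpow_one]

theorem lintegral_rpow_le_of_weak_type_of_ne_top {M : Ω → ℝ} {f : Ω → ℝ≥0∞} {p : ℝ}
    (hM : Measurable M) (hM0 : 0 ≤ M) (hf : Measurable f) (hp : 1 < p)
    (hweak : ∀ t : ℝ, 0 < t → ENNReal.ofReal t * P {ω | t ≤ M ω} ≤ ∫⁻ ω in {ω | t ≤ M ω}, f ω ∂P)
    (hfin : ∫⁻ ω, ENNReal.ofReal (M ω ^ p) ∂P ≠ ∞) :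
    ∫⁻ ω, ENNReal.ofReal (M ω ^ p) ∂P ≤ ENNReal.ofReal (p / (p - 1)) ^ p * ∫⁻ ω, f ω ^ p ∂P := by
  have hp1 : 0 < p - 1 := by linarith
  have hpow (ω : Ω) :
      ENNReal.ofReal (M ω ^ (p - 1)) ^ (p / (p - 1)) = ENNReal.ofReal (M ω ^ p) := by
    rw [ENNReal.ofReal_rpow_of_nonneg (Real.rpow_nonneg (hM0 ω) _) (by positivity),
      ← Real.rpow_mul (hM0 ω), mul_div_cancel₀ _ hp1.ne']
  have hoelder := ENNReal.lintegral_mul_le_Lp_mul_Lq P (Real.HolderConjugate.conjExponent hp)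
    hf.aemeasurable (g := fun ω => ENNReal.ofReal (M ω ^ (p - 1))) (by fun_prop)
  simp only [Pi.mul_apply, Real.conjExponent, hpow] at hoelder
  exact le_rpow_mul_of_le_mul_rpow_one_div hp hfin <|
    (lintegral_rpow_le_lintegral_mul_rpow_sub_one hM hM0 hf hp hweak).trans (by gcongr)

theorem lintegral_rpow_le_of_weak_type [IsFiniteMeasure P] {M : Ω → ℝ} {f : Ω → ℝ≥0∞} {p : ℝ}
    (hM : Measurable M) (hM0 : 0 ≤ M) (hf : Measurable f) (hp : 1 < p)
    (hweak : ∀ t : ℝ, 0 < t → ENNReal.ofReal t * P {ω | t ≤ M ω} ≤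
      ∫⁻ ω in {ω | t ≤ M ω}, f ω ∂P) :
    ∫⁻ ω, ENNReal.ofReal (M ω) ^ p ∂P ≤ ENNReal.ofReal (p / (p - 1)) ^ p * ∫⁻ ω, f ω ^ p ∂P := by
  have truncated (N : ℕ) : ∫⁻ ω, ENNReal.ofReal (min (M ω) N ^ p) ∂P ≤
      ENNReal.ofReal (p / (p - 1)) ^ p * ∫⁻ ω, f ω ^ p ∂P := by
    have hN0 (ω : Ω) : 0 ≤ min (M ω) N := le_min (hM0 ω) N.cast_nonneg
    refine lintegral_rpow_le_of_weak_type_of_ne_top (by fun_prop) hN0 hf hp (fun t ht => ?_) ?_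
    · rcases le_or_gt t N with htN | htN
      · simpa only [le_min_iff, htN, and_true] using hweak t ht
      · simp [htN.not_ge]
    · refine ne_top_of_le_ne_top (b := ∫⁻ _, ENNReal.ofReal ((N : ℝ) ^ p) ∂P)
        (by simp [ENNReal.mul_eq_top]) (lintegral_mono fun ω => ?_)
      have := hN0 ω
      gcongr
      exact min_le_right _ _
  have hmono : Monotone fun (N : ℕ) ω => ENNReal.ofReal (min (M ω) N ^ p) := fun N N' h ω => by
    have := le_min (hM0 ω) N.cast_nonneg
    dsimp only
    gcongr
  calc ∫⁻ ω, ENNReal.ofReal (M ω) ^ p ∂P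
      ≤ ∫⁻ ω, ⨆ N : ℕ, ENNReal.ofReal (min (M ω) N ^ p) ∂P := lintegral_mono fun ω => by
        obtain ⟨N, hN⟩ := exists_nat_ge (M ω)
        rw [ENNReal.ofReal_rpow_of_nonneg (hM0 ω) (by linarith)]
        exact le_iSup_of_le N (by rw [min_eq_left hN])
    _ = ⨆ N : ℕ, ∫⁻ ω, ENNReal.ofReal (min (M ω) N ^ p) ∂P :=
        lintegral_iSup (fun N => by fun_prop) hmono
    _ ≤ _ := iSup_le truncated

end StrongType

section Martingale

variable {Ω : Type*} {m0 : MeasurableSpace Ω} {P : Measure Ω} {𝒢 : Filtration ℕ m0}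

theorem lt_partialSups_iff {α : Type*} [LinearOrder α] {f : ℕ → α} {n : ℕ} {a : α} :
    a < partialSups f n ↔ ∃ k ≤ n, a < f k := by
  simpa only [not_le, not_forall, exists_prop] using not_congr (partialSups_le_iff (f := f))

theorem measurable_partialSups {f : ℕ → Ω → ℝ} (hf : ∀ k, Measurable (f k)) (n : ℕ) :
    Measurable (partialSups f n) := by
  rw [partialSups_apply]
  exact Finset.measurable_sup' _ fun k _ => hf k

theorem partialSups_nonneg {f : ℕ → Ω → ℝ} (hf : ∀ k, 0 ≤ f k) (n : ℕ) : 0 ≤ partialSups f n :=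
  (hf 0).trans (le_partialSups_of_le f n.zero_le)

theorem submartingale_partialSups {f : ℕ → ℕ → Ω → ℝ}
    (hf : ∀ j, Submartingale (fun i => f i j) 𝒢 P) (n : ℕ) :
    Submartingale (fun i => partialSups (f i) n) 𝒢 P := by
  induction n with
  | zero => simpa only [partialSups_zero] using hf 0
  | succ n ih =>
    simp only [partialSups_add_one]
    exact ih.sup (hf (n + 1))

theorem submartingale_abs {R : ℕ → Ω → ℝ} (hR : Martingale R 𝒢 P) :
    Submartingale (fun k ω => |R k ω|) 𝒢 P :=
  hR.submartingale.sup hR.neg.submartingale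

theorem doob_weak_type [IsFiniteMeasure P] {f : ℕ → Ω → ℝ} (hf : Submartingale f 𝒢 P)
    (h0 : ∀ k, 0 ≤ f k) (n : ℕ) {t : ℝ} (ht : 0 < t) :
    ENNReal.ofReal t * P {ω | t ≤ partialSups f n ω} ≤
      ∫⁻ ω in {ω | t ≤ partialSups f n ω}, ENNReal.ofReal (f n ω) ∂P := by
  have hsup (ω : Ω) : partialSups f n ω =
      (Finset.range (n + 1)).sup' Finset.nonempty_range_add_one fun k => f k ω := by
    simp only [Pi.partialSups_apply, partialSups_apply, Nat.range_succ_eq_Iic]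
  have h := maximal_ineq hf h0 (ε := ⟨t, ht.le⟩) n
  rw [ofReal_integral_eq_lintegral_ofReal (hf.integrable n).integrableOn
    (Eventually.of_forall (h0 n))] at h
  simp only [ENNReal.ofReal_eq_coe_nnreal ht.le, hsup]
  exact h

theorem doob_lintegral_rpow [IsFiniteMeasure P] {f : ℕ → Ω → ℝ} (hf : Submartingale f 𝒢 P)
    (h0 : ∀ k, 0 ≤ f k) (n : ℕ) {p : ℝ} (hp : 1 < p) :
    ∫⁻ ω, ENNReal.ofReal (partialSups f n ω) ^ p ∂P ≤
      ENNReal.ofReal (p / (p - 1)) ^ p * ∫⁻ ω, ENNReal.ofReal (f n ω) ^ p ∂P := by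
  have hm (k : ℕ) : Measurable (f k) := ((hf.stronglyMeasurable k).mono (𝒢.le k)).measurable
  exact lintegral_rpow_le_of_weak_type (measurable_partialSups hm n) (partialSups_nonneg h0 n)
    (hm n).ennreal_ofReal hp fun t ht => doob_weak_type hf h0 n ht

theorem measurableSet_disjointed {A : ℕ → Set Ω} (hA : ∀ i, MeasurableSet[𝒢 i] (A i)) (i : ℕ) :
    MeasurableSet[𝒢 i] (disjointed A i) := by
  rw [disjointed_eq_inter_compl]
  exact (hA i).inter <| .biInter (Set.to_countable _) fun k hk =>
    (𝒢.mono (le_of_lt hk) _ (hA k)).compl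

theorem ottaviani {R : ℕ → Ω → ℝ} (hR : ∀ i, Measurable[𝒢 i] (R i)) {n : ℕ}
    (hind : ∀ i ≤ n, Indep (𝒢 i) (MeasurableSpace.comap (R n - R i) inferInstance) P)
    {y : ℝ} {α : ℝ≥0∞} (hy : ∀ i ≤ n, α ≤ P {ω | |R n ω - R i ω| ≤ y}) (x : ℝ) :
    α * P {ω | x + y < partialSups (fun k ω => |R k ω|) n ω} ≤ P {ω | x < |R n ω|} := by
  let exceeds (i : ℕ) : Set Ω := {ω | x + y < |R i ω|}
  let near (i : ℕ) : Set Ω := {ω | |R n ω - R i ω| ≤ y}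
  have hR' (i : ℕ) : Measurable (R i) := (hR i).mono (𝒢.le i) le_rfl
  have measurable_first : ∀ i, MeasurableSet[𝒢 i] (disjointed exceeds i) :=
    measurableSet_disjointed fun i => hR i (measurableSet_lt measurable_const measurable_norm)
  have indep_near (i : ℕ) (hi : i ≤ n) :
      P (disjointed exceeds i ∩ near i) = P (disjointed exceeds i) * P (near i) :=
    (Indep_iff _ _ _).1 (hind i hi) _ _ (measurable_first i)
      ⟨{z | |z| ≤ y}, measurableSet_le measurable_norm measurable_const, rfl⟩
  have hnear (i : ℕ) : MeasurableSet (near i) :=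
    measurableSet_le ((hR' n).sub (hR' i)).norm measurable_const
  calc α * P {ω | x + y < partialSups (fun k ω => |R k ω|) n ω}
      = α * P (⋃ i ∈ Finset.Iic n, disjointed exceeds i) := by
        rw [biUnion_Iic_disjointed, partialSups_eq_biSup]
        congr 2
        ext ω
        simp [Pi.partialSups_apply, lt_partialSups_iff, exceeds]
    _ ≤ α * ∑ i ∈ Finset.Iic n, P (disjointed exceeds i) := by
        gcongr
        exact measure_biUnion_finset_le _ _
    _ ≤ ∑ i ∈ Finset.Iic n, P (disjointed exceeds i ∩ near i) := by
        rw [Finset.mul_sum]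
        refine Finset.sum_le_sum fun i hi => ?_
        rw [indep_near i (Finset.mem_Iic.1 hi), mul_comm]
        gcongr
        exact hy i (Finset.mem_Iic.1 hi)
    _ = P (⋃ i ∈ Finset.Iic n, disjointed exceeds i ∩ near i) :=
        (measure_biUnion_finset (fun i _ j _ hij => (disjoint_disjointed exceeds hij).mono
          Set.inter_subset_left Set.inter_subset_left)
          fun i _ => (𝒢.le i _ (measurable_first i)).inter (hnear i)).symm
    _ ≤ P {ω | x < |R n ω|} := by
        gcongr
        refine Set.iUnion₂_subset fun i _ ω ⟨hfirst, (hclose : |R n ω - R i ω| ≤ y)⟩ => ?_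
        have hi : x + y < |R i ω| := disjointed_subset exceeds i hfirst
        have htri := abs_sub_abs_le_abs_sub (R i ω) (R n ω)
        rw [abs_sub_comm] at htri
        change x < |R n ω|
        linarith

theorem inv_two_le_measure_le_of_lintegral_le [IsProbabilityMeasure P] {W : Ω → ℝ≥0∞} {y : ℝ≥0∞}
    (hW : Measurable W) (h : ∫⁻ ω, W ω ∂P ≤ y * 2⁻¹) : 2⁻¹ ≤ P {ω | W ω ≤ y} := by
  have hlt : P {ω | y < W ω} ≤ 2⁻¹ := by
    rcases eq_or_ne y 0 with rfl | hy0
    · have hzero : W =ᵐ[P] 0 := (lintegral_eq_zero_iff hW).1 (by simpa using h)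
      have hnull : P {ω | 0 < W ω} = 0 := by
        simpa only [EventuallyEq, ae_iff, Pi.zero_apply, ← pos_iff_ne_zero] using hzero
      simp only [hnull, zero_le]
    rcases eq_or_ne y ∞ with rfl | hy
    · simp
    · rw [← ENNReal.mul_le_mul_iff_right hy0 hy]
      calc y * P {ω | y < W ω} ≤ y * P {ω | y ≤ W ω} := by
            gcongr with ω
            exact le_of_lt
        _ ≤ y * 2⁻¹ := (mul_meas_ge_le_lintegral hW y).trans h
  have hcompl : {ω | W ω ≤ y} = {ω | y < W ω}ᶜ := by ext; simp
  rw [hcompl, prob_compl_eq_one_sub (measurableSet_lt measurable_const hW)]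
  exact ENNReal.one_sub_inv_two.ge.trans (tsub_le_tsub_left hlt 1)

theorem lintegral_partialSups_abs_le_add [IsProbabilityMeasure P] {R : ℕ → Ω → ℝ}
    (hR : ∀ i, Measurable[𝒢 i] (R i)) {n : ℕ}
    (hind : ∀ i ≤ n, Indep (𝒢 i) (MeasurableSpace.comap (R n - R i) inferInstance) P)
    {y : ℝ} (hy : ∀ i ≤ n, 2⁻¹ ≤ P {ω | |R n ω - R i ω| ≤ y}) :
    ∫⁻ ω, ENNReal.ofReal (partialSups (fun k ω => |R k ω|) n ω) ∂P ≤
      ENNReal.ofReal y + 2 * ∫⁻ ω, ENNReal.ofReal |R n ω| ∂P := by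
  have hR' (i : ℕ) : Measurable (R i) := (hR i).mono (𝒢.le i) le_rfl
  set M := partialSups (fun k ω => |R k ω|) n
  have hM : Measurable M := measurable_partialSups (fun k => (hR' k).norm) n
  have excess : ∫⁻ ω, ENNReal.ofReal (max (M ω - y) 0) ∂P ≤
      2 * ∫⁻ ω, ENNReal.ofReal |R n ω| ∂P := by
    rw [lintegral_eq_lintegral_meas_lt P (f := fun ω => max (M ω - y) 0)
        (Eventually.of_forall fun ω => le_max_right _ _) (by fun_prop),
      lintegral_eq_lintegral_meas_lt P (Eventually.of_forall fun ω => abs_nonneg _)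
        (hR' n).norm.aemeasurable,
      ← lintegral_const_mul' _ _ (by simp)]
    refine setLIntegral_mono' measurableSet_Ioi fun t (ht : 0 < t) => ?_
    calc P {ω | t < max (M ω - y) 0} = P {ω | t + y < M ω} := by
          simp only [lt_max_iff, ht.not_gt, or_false, lt_sub_iff_add_lt]
      _ ≤ 2 * P {ω | t < |R n ω|} := by
          rw [← ENNReal.inv_mul_le_iff two_ne_zero ENNReal.ofNat_ne_top]
          exact ottaviani hR hind hy t
  calc ∫⁻ ω, ENNReal.ofReal (M ω) ∂P
      ≤ ∫⁻ ω, (ENNReal.ofReal y + ENNReal.ofReal (max (M ω - y) 0)) ∂P := by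
        refine lintegral_mono fun ω => le_trans (ENNReal.ofReal_le_ofReal ?_) ENNReal.ofReal_add_le
        linarith [le_max_left (M ω - y) 0]
    _ = ENNReal.ofReal y + ∫⁻ ω, ENNReal.ofReal (max (M ω - y) 0) ∂P := by
        rw [lintegral_add_left measurable_const, lintegral_const, measure_univ, mul_one]
    _ ≤ ENNReal.ofReal y + 2 * ∫⁻ ω, ENNReal.ofReal |R n ω| ∂P := by gcongr

theorem lintegral_partialSups_abs_le [IsProbabilityMeasure P] {R : ℕ → Ω → ℝ}
    (hR : Martingale R 𝒢 P) {n : ℕ}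
    (hind : ∀ i ≤ n, Indep (𝒢 i) (MeasurableSpace.comap (R n - R i) inferInstance) P) :
    ∫⁻ ω, ENNReal.ofReal (partialSups (fun k ω => |R k ω|) n ω) ∂P ≤
      6 * ∫⁻ ω, ENNReal.ofReal |R n ω| ∂P := by
  have hm (i : ℕ) : Measurable (R i) := ((hR.stronglyMeasurable i).mono (𝒢.le i)).measurable
  have ofReal_integral (i : ℕ) :
      ∫⁻ ω, ENNReal.ofReal |R i ω| ∂P = ENNReal.ofReal (∫ ω, |R i ω| ∂P) :=
    (ofReal_integral_eq_lintegral_ofReal (hR.integrable i).abs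
      (Eventually.of_forall fun ω => abs_nonneg _)).symm
  set m := ∫ ω, |R n ω| ∂P
  have hm0 : 0 ≤ m := integral_nonneg fun ω => abs_nonneg _
  have increment_le (i : ℕ) (hi : i ≤ n) :
      ∫⁻ ω, ENNReal.ofReal |R n ω - R i ω| ∂P ≤ ENNReal.ofReal (4 * m) * 2⁻¹ := by
    have hmono : ∫ ω, |R i ω| ∂P ≤ m := by
      simpa using (submartingale_abs hR).setIntegral_le hi MeasurableSet.univ
    calc ∫⁻ ω, ENNReal.ofReal |R n ω - R i ω| ∂P
        ≤ ∫⁻ ω, (ENNReal.ofReal |R n ω| + ENNReal.ofReal |R i ω|) ∂P :=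
          lintegral_mono fun ω =>
            (ENNReal.ofReal_le_ofReal (abs_sub _ _)).trans ENNReal.ofReal_add_le
      _ = ENNReal.ofReal m + ENNReal.ofReal (∫ ω, |R i ω| ∂P) := by
          rw [lintegral_add_left (by fun_prop), ofReal_integral, ofReal_integral]
      _ ≤ ENNReal.ofReal m + ENNReal.ofReal m := by gcongr
      _ = ENNReal.ofReal (4 * m) * 2⁻¹ := by
          rw [← ENNReal.ofReal_add hm0 hm0, ← ENNReal.ofReal_ofNat 2,
            ← ENNReal.ofReal_inv_of_pos two_pos, ← ENNReal.ofReal_mul (by positivity)]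
          ring_nf
  have half (i : ℕ) (hi : i ≤ n) : 2⁻¹ ≤ P {ω | |R n ω - R i ω| ≤ 4 * m} := by
    simpa only [ENNReal.ofReal_le_ofReal_iff (by positivity : 0 ≤ 4 * m)] using
      inv_two_le_measure_le_of_lintegral_le (by fun_prop) (increment_le i hi)
  refine (lintegral_partialSups_abs_le_add (fun i => (hR.stronglyMeasurable i).measurable)
    hind half).trans_eq ?_
  rw [show ∫⁻ ω, ENNReal.ofReal |R n ω| ∂P = ENNReal.ofReal m from ofReal_integral n,
    ENNReal.ofReal_mul (by norm_num), ← add_mul]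
  norm_num

end Martingale

section Sums

variable {Ω ι : Type*} {ξ : ι → Ω → ℝ}

theorem measurable_sum_of_subset {s : Finset ι} {S : Set ι} (hs : ↑s ⊆ S) :
    Measurable[⨆ k ∈ S, MeasurableSpace.comap (ξ k) inferInstance] (∑ k ∈ s, ξ k) := by
  rw [Finset.sum_fn]
  exact Finset.measurable_sum s fun k hk =>
    (comap_measurable (ξ k)).mono (le_iSup₂_of_le k (hs hk) le_rfl) le_rfl

theorem sum_filter_le_sub_sum_filter_le {ι M : Type*} [AddCommGroup M] (ξ : ι → M) (f : ι → ℕ)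
    (s : Finset ι) {i n : ℕ} (h : i ≤ n) :
    ∑ k ∈ s with f k ≤ n, ξ k - ∑ k ∈ s with f k ≤ i, ξ k =
      ∑ k ∈ s with f k ≤ n ∧ i < f k, ξ k := by
  have hle : s.filter (f · ≤ i) = (s.filter (f · ≤ n)).filter (f · ≤ i) := by
    rw [Finset.filter_filter]
    exact Finset.filter_congr fun k _ => ⟨fun hk => ⟨hk.trans h, hk⟩, And.right⟩
  rw [sub_eq_iff_eq_add', hle, ← Finset.sum_filter_add_sum_filter_not _ (f · ≤ i),
    Finset.filter_filter (f · ≤ n) (¬f · ≤ i)]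
  simp only [not_le]

/-- The two-parameter partial sums of `ξ` over `s`, with respect to two gradings of the indices. -/
def gridSum (ξ : ι → Ω → ℝ) (s : Finset ι) (f g : ι → ℕ) (i j : ℕ) : Ω → ℝ :=
  ∑ k ∈ s with f k ≤ i ∧ g k ≤ j, ξ k

/-- The maximal function `max |S i j|`, over `i ≤ m` and `j ≤ n`, of the two-parameter sums `S`. -/
noncomputable def gridMax (ξ : ι → Ω → ℝ) (s : Finset ι) (f g : ι → ℕ) (m n : ℕ) : Ω → ℝ :=
  partialSups (fun i => partialSups (fun j ω => |gridSum ξ s f g i j ω|) n) m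

theorem gridSum_comm (ξ : ι → Ω → ℝ) (s : Finset ι) (f g : ι → ℕ) (i j : ℕ) :
    gridSum ξ s f g i j = gridSum ξ s g f j i := by
  simp only [gridSum, and_comm]

theorem gridSum_eq_sum_filter (ξ : ι → Ω → ℝ) (s : Finset ι) (f g : ι → ℕ) (i j : ℕ) :
    gridSum ξ s f g i j = ∑ k ∈ s.filter (f · ≤ i) with g k ≤ j, ξ k := by
  rw [gridSum, Finset.filter_filter]

theorem abs_gridSum_le_gridMax (ξ : ι → Ω → ℝ) (s : Finset ι) (f g : ι → ℕ) {i j m n : ℕ}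
    (hi : i ≤ m) (hj : j ≤ n) (ω : Ω) : |gridSum ξ s f g i j ω| ≤ gridMax ξ s f g m n ω :=
  (le_partialSups_of_le (fun j ω => |gridSum ξ s f g i j ω|) hj ω).trans
    (le_partialSups_of_le (fun i => partialSups (fun j ω => |gridSum ξ s f g i j ω|) n) hi ω)

end Sums

section IndependentSums

variable {Ω ι : Type*} [m0 : MeasurableSpace Ω] {P : Measure Ω} {ξ : ι → Ω → ℝ}

/-- A family of independent integrable real random variables of mean zero. -/
structure IsIndepCentred (ξ : ι → Ω → ℝ) (P : Measure Ω) : Prop where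
  measurable : ∀ k, Measurable (ξ k)
  iIndepFun : iIndepFun ξ P
  integrable : ∀ k, Integrable (ξ k) P
  integral_eq_zero : ∀ k, ∫ ω, ξ k ω ∂P = 0

/-- The filtration whose `i`-th σ-algebra is generated by the members of the family `ξ` whose
index has grade at most `i`. -/
def gradedFiltration (ξ : ι → Ω → ℝ) (hξ : ∀ k, Measurable (ξ k)) (f : ι → ℕ) :
    Filtration ℕ m0 where
  seq i := ⨆ k ∈ {k | f k ≤ i}, MeasurableSpace.comap (ξ k) inferInstance
  mono' _ _ hij := biSup_mono fun _ hk => le_trans hk hij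
  le' _ := iSup₂_le fun k _ => (hξ k).comap_le

namespace IsIndepCentred

theorem indep_gradedFiltration_sum (hξ : IsIndepCentred ξ P) {f : ι → ℕ} {i : ℕ} {s : Finset ι}
    (hs : ∀ k ∈ s, i < f k) :
    Indep (gradedFiltration ξ hξ.measurable f i)
      (MeasurableSpace.comap (∑ k ∈ s, ξ k) inferInstance) P :=
  have hdisj : Disjoint {k | f k ≤ i} {k | i < f k} :=
    Set.disjoint_left.2 fun _ hk hk' => not_lt.2 (Set.mem_ofPred_eq ▸ hk) hk'
  indep_of_indep_of_le_right
    (indep_iSup_of_disjoint (fun k => (hξ.measurable k).comap_le) hξ.iIndepFun hdisj)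
    (measurable_sum_of_subset hs).comap_le

theorem indep_gradedFiltration_increment (hξ : IsIndepCentred ξ P) (f : ι → ℕ) (s : Finset ι)
    {i n : ℕ} (h : i ≤ n) :
    Indep (gradedFiltration ξ hξ.measurable f i)
      (MeasurableSpace.comap (∑ k ∈ s with f k ≤ n, ξ k - ∑ k ∈ s with f k ≤ i, ξ k)
        inferInstance) P := by
  rw [sum_filter_le_sub_sum_filter_le ξ f s h]
  exact hξ.indep_gradedFiltration_sum fun k hk => (Finset.mem_filter.1 hk).2.2

theorem integral_sum_eq_zero (hξ : IsIndepCentred ξ P) (s : Finset ι) :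
    ∫ ω, (∑ k ∈ s, ξ k) ω ∂P = 0 := by
  simp only [Finset.sum_apply]
  rw [integral_finsetSum _ fun k _ => hξ.integrable k]
  exact Finset.sum_eq_zero fun k _ => hξ.integral_eq_zero k

theorem martingale_sum_filter [IsProbabilityMeasure P] (hξ : IsIndepCentred ξ P)
    (f : ι → ℕ) (s : Finset ι) :
    Martingale (fun i => ∑ k ∈ s with f k ≤ i, ξ k) (gradedFiltration ξ hξ.measurable f) P := by
  refine martingale_of_condExp_sub_eq_zero_nat (fun i => ?_)
    (fun i => integrable_finsetSum' _ fun k _ => hξ.integrable k) fun i => ?_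
  · exact (measurable_sum_of_subset (S := {k | f k ≤ i})
      fun k hk => (Finset.mem_filter.1 hk).2).stronglyMeasurable
  · have hindep := hξ.indep_gradedFiltration_increment f s i.le_succ
    rw [sum_filter_le_sub_sum_filter_le ξ f s i.le_succ] at hindep ⊢
    have hmeas (t : Finset ι) : Measurable (∑ k ∈ t, ξ k) := by
      rw [Finset.sum_fn]
      exact Finset.measurable_sum t fun k _ => hξ.measurable k
    filter_upwards [condExp_indep_eq (hmeas _).comap_le
      ((gradedFiltration ξ hξ.measurable f).le i) (comap_measurable _).stronglyMeasurable
      hindep.symm] with ω hω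
    rw [hω, hξ.integral_sum_eq_zero, Pi.zero_apply]

variable [IsProbabilityMeasure P]

theorem martingale_gridSum (hξ : IsIndepCentred ξ P) (s : Finset ι) (f g : ι → ℕ) (i : ℕ) :
    Martingale (gridSum ξ s f g i) (gradedFiltration ξ hξ.measurable g) P := by
  convert hξ.martingale_sum_filter g (s.filter (f · ≤ i)) using 2 with j
  exact gridSum_eq_sum_filter ξ s f g i j

theorem submartingale_gridMax_row (hξ : IsIndepCentred ξ P) (s : Finset ι) (f g : ι → ℕ)
    (n : ℕ) :
    Submartingale (fun i => partialSups (fun j ω => |gridSum ξ s f g i j ω|) n)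
      (gradedFiltration ξ hξ.measurable f) P :=
  submartingale_partialSups (fun j => by
    simp only [gridSum_comm ξ s f g _ j]
    exact submartingale_abs (hξ.martingale_gridSum s g f j)) n

theorem cairoli_weak_type (hξ : IsIndepCentred ξ P) (s : Finset ι) (f g : ι → ℕ) (m n : ℕ)
    {t : ℝ} (ht : 0 < t) :
    ENNReal.ofReal t * P {ω | t ≤ gridMax ξ s f g m n ω} ≤
      6 * ∫⁻ ω, ENNReal.ofReal |gridSum ξ s f g m n ω| ∂P :=
  calc ENNReal.ofReal t * P {ω | t ≤ gridMax ξ s f g m n ω}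
      ≤ ∫⁻ ω in {ω | t ≤ gridMax ξ s f g m n ω},
          ENNReal.ofReal (partialSups (fun j ω => |gridSum ξ s f g m j ω|) n ω) ∂P :=
        doob_weak_type (hξ.submartingale_gridMax_row s f g n)
          (fun _ => partialSups_nonneg (fun _ _ => abs_nonneg _) n) m ht
    _ ≤ ∫⁻ ω, ENNReal.ofReal (partialSups (fun j ω => |gridSum ξ s f g m j ω|) n ω) ∂P :=
        setLIntegral_le_lintegral _ _
    _ ≤ 6 * ∫⁻ ω, ENNReal.ofReal |gridSum ξ s f g m n ω| ∂P :=
        lintegral_partialSups_abs_le (hξ.martingale_gridSum s f g m) fun i hi => by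
          simp only [gridSum_eq_sum_filter]
          exact hξ.indep_gradedFiltration_increment g _ hi

theorem cairoli_lintegral_rpow (hξ : IsIndepCentred ξ P) (s : Finset ι) (f g : ι → ℕ) (m n : ℕ)
    {p : ℝ} (hp : 1 < p) :
    ∫⁻ ω, ENNReal.ofReal (gridMax ξ s f g m n ω) ^ p ∂P ≤
      ENNReal.ofReal (p / (p - 1)) ^ (2 * p) *
        ∫⁻ ω, ENNReal.ofReal |gridSum ξ s f g m n ω| ^ p ∂P := by
  set C := ENNReal.ofReal (p / (p - 1)) ^ p with hC
  calc ∫⁻ ω, ENNReal.ofReal (gridMax ξ s f g m n ω) ^ p ∂P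
      ≤ C * ∫⁻ ω, ENNReal.ofReal (partialSups (fun j ω => |gridSum ξ s f g m j ω|) n ω) ^ p ∂P :=
        doob_lintegral_rpow (hξ.submartingale_gridMax_row s f g n)
          (fun _ => partialSups_nonneg (fun _ _ => abs_nonneg _) n) m hp
    _ ≤ C * (C * ∫⁻ ω, ENNReal.ofReal |gridSum ξ s f g m n ω| ^ p ∂P) := by
        gcongr
        exact doob_lintegral_rpow (submartingale_abs (hξ.martingale_gridSum s f g m))
          (fun _ _ => abs_nonneg _) n hp
    _ = _ := by
        rw [← mul_assoc, hC, ← ENNReal.rpow_add_of_nonneg _ _ (by linarith) (by linarith),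
          two_mul]

end IsIndepCentred

end IndependentSums

section RandomMeasure

variable {α Ω : Type*} [MeasurableSpace α] [Bornology α] [MeasurableSpace Ω]

/-- An independently scattered random measure: the part of the definition of a Lévy basis that does
not concern the marginal laws, on a space with a notion of bounded set. -/
structure IsIndepScattered (Λ : Set α → Ω → ℝ) (P : Measure Ω) : Prop where
  measurable : ∀ A : Set α, MeasurableSet A → Bornology.IsBounded A → Measurable (Λ A)
  indep : ∀ A : ℕ → Set α, (∀ n, MeasurableSet (A n)) → (∀ n, Bornology.IsBounded (A n)) →
    Pairwise (Function.onFun Disjoint A) → iIndepFun (fun n => Λ (A n)) P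
  sigma_additive : ∀ A : ℕ → Set α, (∀ n, MeasurableSet (A n)) → Bornology.IsBounded (⋃ n, A n) →
    Pairwise (Function.onFun Disjoint A) →
    ∀ᵐ ω ∂P, Tendsto (fun N : ℕ => ∑ n ∈ Finset.range N, Λ (A n) ω) atTop (𝓝 (Λ (⋃ n, A n) ω))

/-- The values of `Λ` at bounded sets are integrable with mean zero; this is `HasMeanZero` on a
general space. -/
def IsCentred (Λ : Set α → Ω → ℝ) (P : Measure Ω) : Prop :=
  ∀ A : Set α, MeasurableSet A → Bornology.IsBounded A → Integrable (Λ A) P ∧ ∫ ω, Λ A ω ∂P = 0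

namespace IsIndepScattered

variable {P : Measure Ω} {Λ : Set α → Ω → ℝ}

theorem ae_empty (hΛ : IsIndepScattered Λ P) : ∀ᵐ ω ∂P, Λ ∅ ω = 0 := by
  have h := hΛ.sigma_additive (fun _ => ∅) (fun _ => MeasurableSet.empty) (by simp)
    fun i j _ => disjoint_bot_left
  filter_upwards [h] with ω hω
  have hdiff := ((tendsto_add_atTop_iff_nat 1).2 hω).sub hω
  simp only [Finset.sum_range_succ, add_sub_cancel_left, sub_self] at hdiff
  exact tendsto_nhds_unique tendsto_const_nhds hdiff

theorem ae_union (hΛ : IsIndepScattered Λ P) {A B : Set α} (hA : MeasurableSet A)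
    (hB : MeasurableSet B) (hA' : Bornology.IsBounded A) (hB' : Bornology.IsBounded B)
    (hAB : Disjoint A B) : ∀ᵐ ω ∂P, Λ (A ∪ B) ω = Λ A ω + Λ B ω := by
  let S : ℕ → Set α
    | 0 => A
    | 1 => B
    | _ => ∅
  have hS : ⋃ n, S n = A ∪ B :=
    subset_antisymm (Set.iUnion_subset fun
      | 0 => Set.subset_union_left
      | 1 => Set.subset_union_right
      | _ + 2 => Set.empty_subset _)
      (Set.union_subset (Set.subset_iUnion S 0) (Set.subset_iUnion S 1))
  have hmeas : ∀ n, MeasurableSet (S n)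
    | 0 => hA
    | 1 => hB
    | _ + 2 => MeasurableSet.empty
  have hdisj : Pairwise (Function.onFun Disjoint S) := by
    rintro (_ | _ | i) (_ | _ | j) hij <;> simp_all [S, Function.onFun, hAB.symm]
  filter_upwards [hΛ.sigma_additive S hmeas (hS ▸ hA'.union hB') hdisj, hΛ.ae_empty] with ω hω h0
  rw [hS, ← tendsto_add_atTop_iff_nat 2] at hω
  simp only [Finset.sum_range_succ', S, h0, Finset.sum_const_zero, zero_add] at hω
  exact (tendsto_nhds_unique hω tendsto_const_nhds).trans (add_comm _ _)

theorem ae_biUnion_finset (hΛ : IsIndepScattered Λ P) {ι : Type*} (s : Finset ι) {A : ι → Set α}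
    (hA : ∀ k, MeasurableSet (A k)) (hA' : ∀ k, Bornology.IsBounded (A k))
    (hd : Pairwise (Function.onFun Disjoint A)) :
    ∀ᵐ ω ∂P, Λ (⋃ k ∈ s, A k) ω = ∑ k ∈ s, Λ (A k) ω := by
  classical
  induction s using Finset.induction_on with
  | empty => simpa using hΛ.ae_empty
  | insert a s ha ih =>
    have hunion := hΛ.ae_union (hA a) (s.measurableSet_biUnion fun k _ => hA k) (hA' a)
      ((Bornology.isBounded_biUnion_finset s).2 fun k _ => hA' k)
      (Set.disjoint_iUnion₂_right.2 fun k hk => hd (ne_of_mem_of_not_mem hk ha).symm)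
    filter_upwards [ih, hunion] with ω hs hω
    rw [Finset.set_biUnion_insert, hω, hs, Finset.sum_insert ha]

theorem ae_tendsto_iUnion (hΛ : IsIndepScattered Λ P) {A : ℕ → Set α}
    (hA : ∀ n, MeasurableSet (A n)) (hbdd : Bornology.IsBounded (⋃ n, A n)) (hmono : Monotone A) :
    ∀ᵐ ω ∂P, Tendsto (fun n => Λ (A n) ω) atTop (𝓝 (Λ (⋃ n, A n) ω)) := by
  have hdA (n : ℕ) : MeasurableSet (disjointed A n) := MeasurableSet.disjointed hA n
  have hsum (n : ℕ) : ∀ᵐ ω ∂P, Λ (A n) ω = ∑ k ∈ Finset.range (n + 1), Λ (disjointed A k) ω := by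
    have h := hΛ.ae_biUnion_finset (Finset.range (n + 1)) hdA
      (fun k => hbdd.subset ((disjointed_subset A k).trans (Set.subset_iUnion A k)))
      (disjoint_disjointed A)
    rwa [biUnion_range_succ_disjointed, hmono.partialSups_eq] at h
  filter_upwards [hΛ.sigma_additive (disjointed A) hdA (by rwa [iUnion_disjointed])
    (disjoint_disjointed A), ae_all_iff.2 hsum] with ω hω hsumω
  rw [iUnion_disjointed, ← tendsto_add_atTop_iff_nat 1] at hω
  simpa only [hsumω] using hω

theorem ae_sdiff (hΛ : IsIndepScattered Λ P) {A B : Set α} (hA : MeasurableSet A)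
    (hB : MeasurableSet B) (hA' : Bornology.IsBounded A) (hBA : B ⊆ A) :
    ∀ᵐ ω ∂P, Λ (A \ B) ω = Λ A ω - Λ B ω := by
  filter_upwards [hΛ.ae_union hB (hA.diff hB) (hA'.subset hBA) (hA'.subset Set.sdiff_subset)
    Set.disjoint_sdiff_right] with ω hω
  rw [Set.union_sdiff_cancel hBA] at hω
  rw [hω, add_sub_cancel_left]

theorem ae_tendsto_iInter (hΛ : IsIndepScattered Λ P) {A : ℕ → Set α}
    (hA : ∀ n, MeasurableSet (A n)) (hbdd : Bornology.IsBounded (A 0)) (hanti : Antitone A) :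
    ∀ᵐ ω ∂P, Tendsto (fun n => Λ (A n) ω) atTop (𝓝 (Λ (⋂ n, A n) ω)) := by
  have hunion : ⋃ n, A 0 \ A n = A 0 \ ⋂ n, A n := (Set.sdiff_iInter _ _).symm
  have hlim := hΛ.ae_tendsto_iUnion (fun n => (hA 0).diff (hA n))
    (hunion ▸ hbdd.subset Set.sdiff_subset) fun m n h => Set.sdiff_subset_sdiff_right (hanti h)
  rw [hunion] at hlim
  filter_upwards [hlim, hΛ.ae_sdiff (hA 0) (MeasurableSet.iInter hA) hbdd (Set.iInter_subset A 0),
    ae_all_iff.2 fun n => hΛ.ae_sdiff (hA 0) (hA n) hbdd (hanti n.zero_le)] with ω hω hInter hn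
  simp only [hInter, hn] at hω
  simpa only [sub_sub_cancel] using hω.const_sub (Λ (A 0) ω)

theorem ae_inter_preimage_finset (hΛ : IsIndepScattered Λ P) {ι : Type*} [MeasurableSpace ι]
    [MeasurableSingletonClass ι] {B : Set α} (hB : MeasurableSet B) (hB' : Bornology.IsBounded B)
    {h : α → ι} (hh : Measurable h) (s : Finset ι) :
    ∀ᵐ ω ∂P, Λ (B ∩ h ⁻¹' s) ω = ∑ k ∈ s, Λ (B ∩ h ⁻¹' {k}) ω := by
  have hunion : B ∩ h ⁻¹' s = ⋃ k ∈ s, B ∩ h ⁻¹' {k} := by ext; simp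
  rw [hunion]
  exact hΛ.ae_biUnion_finset s (fun k => hB.inter (hh (measurableSet_singleton k)))
    (fun k => hB'.subset Set.inter_subset_left) fun i j hij =>
      (Disjoint.preimage h (Set.disjoint_singleton.2 hij)).mono Set.inter_subset_right
        Set.inter_subset_right

theorem isIndepCentred_fibres (hΛ : IsIndepScattered Λ P) (hmean : IsCentred Λ P)
    {ι : Type*} [MeasurableSpace ι] [MeasurableSingletonClass ι] [Denumerable ι] {B : Set α}
    (hB : MeasurableSet B) (hB' : Bornology.IsBounded B) {h : α → ι} (hh : Measurable h) :
    IsIndepCentred (fun k => Λ (B ∩ h ⁻¹' {k})) P := by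
  have hcell (k : ι) : MeasurableSet (B ∩ h ⁻¹' {k}) := hB.inter (hh (measurableSet_singleton k))
  have hcell' (k : ι) : Bornology.IsBounded (B ∩ h ⁻¹' {k}) := hB'.subset Set.inter_subset_left
  refine ⟨fun k => hΛ.measurable _ (hcell k) (hcell' k), ?_,
    fun k => (hmean _ (hcell k) (hcell' k)).1, fun k => (hmean _ (hcell k) (hcell' k)).2⟩
  have hindep := hΛ.indep (fun n => B ∩ h ⁻¹' {(Denumerable.eqv ι).symm n}) (fun n => hcell _)
    (fun n => hcell' _) fun i j hij =>
      (Disjoint.preimage h <| Set.disjoint_singleton.2 <|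
        (Denumerable.eqv ι).symm.injective.ne hij).mono
        Set.inter_subset_right Set.inter_subset_right
  simpa using hindep.precomp (Denumerable.eqv ι).injective

end IsIndepScattered

end RandomMeasure

section Quadrants

/-- The number of elements of the finite set `T` that lie strictly below `x`. -/
def rank {β : Type*} [LinearOrder β] (T : Finset β) (x : β) : ℕ :=
  (T.filter (· < x)).card

theorem monotone_rank {β : Type*} [LinearOrder β] (T : Finset β) : Monotone (rank T) :=
  fun _ _ hxy => Finset.card_le_card <| Finset.monotone_filter_right T fun _ _ ht => ht.trans_le hxy

theorem rank_le_rank_iff {β : Type*} [LinearOrder β] {T : Finset β} {x t : β} (ht : t ∈ T) :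
    rank T x ≤ rank T t ↔ x ≤ t := by
  refine ⟨fun h => ?_, fun h => monotone_rank T h⟩
  contrapose! h
  refine Finset.card_lt_card <| Finset.ssubset_iff_of_subset
    (Finset.monotone_filter_right T fun _ _ hs => hs.trans h) |>.2 ⟨t, ?_, ?_⟩ <;> simp [ht, h]

/-- The rank of a point of the plane in the grid spanned by `F`: the ranks of its two coordinates
among the coordinates of the points of `F`. -/
noncomputable def gridRank (F : Finset (ℝ × ℝ)) (y : ℝ × ℝ) : ℕ × ℕ :=
  (rank (F.image Prod.fst) y.1, rank (F.image Prod.snd) y.2)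

theorem gridRank_le_gridRank_iff {F : Finset (ℝ × ℝ)} {y z : ℝ × ℝ} (hy : y ∈ F) :
    gridRank F z ≤ gridRank F y ↔ z ≤ y :=
  and_congr (rank_le_rank_iff (Finset.mem_image_of_mem _ hy))
    (rank_le_rank_iff (Finset.mem_image_of_mem _ hy))

theorem measurable_gridRank (F : Finset (ℝ × ℝ)) : Measurable (gridRank F) :=
  ((monotone_rank _).measurable.comp measurable_fst).prodMk
    ((monotone_rank _).measurable.comp measurable_snd)

namespace IsIndepScattered

variable {α Ω : Type*} [MeasurableSpace α] [Bornology α] [MeasurableSpace Ω] {P : Measure Ω}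
  {Λ : Set α → Ω → ℝ} {w : α → ℝ × ℝ}

theorem ae_quadrant_eq_gridSum (hΛ : IsIndepScattered Λ P) (hw : Measurable w)
    {F : Finset (ℝ × ℝ)} {x y : ℝ × ℝ} (hbdd : Bornology.IsBounded (w ⁻¹' Set.Iic x))
    (hy : y ∈ F) (hyx : y ≤ x) :
    ∀ᵐ ω ∂P, Λ (w ⁻¹' Set.Iic y) ω =
      gridSum (fun k => Λ (w ⁻¹' Set.Iic x ∩ (gridRank F ∘ w) ⁻¹' {k}))
        (Finset.Iic (gridRank F x)) Prod.fst Prod.snd (gridRank F y).1 (gridRank F y).2 ω := by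
  have hquadrant : w ⁻¹' Set.Iic x ∩ (gridRank F ∘ w) ⁻¹' (Finset.Iic (gridRank F y)) =
      w ⁻¹' Set.Iic y := by
    ext s
    simp only [Finset.coe_Iic, Set.mem_inter_iff, Set.mem_preimage, Set.mem_Iic,
      Function.comp_apply, gridRank_le_gridRank_iff hy, and_iff_right_iff_imp]
    exact fun hs => hs.trans hyx
  have hindices : (Finset.Iic (gridRank F x)).filter
      (fun k => k.1 ≤ (gridRank F y).1 ∧ k.2 ≤ (gridRank F y).2) = Finset.Iic (gridRank F y) := by
    have hle : gridRank F y ≤ gridRank F x :=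
      ⟨monotone_rank _ hyx.1, monotone_rank _ hyx.2⟩
    ext k
    simp only [Finset.mem_filter, Finset.mem_Iic, ← Prod.le_def, and_iff_right_iff_imp]
    exact fun hk => hk.trans hle
  filter_upwards [hΛ.ae_inter_preimage_finset (measurableSet_Iic.preimage hw) hbdd
    ((measurable_gridRank F).comp hw) (Finset.Iic (gridRank F y))] with ω hω
  rw [gridSum, hindices, Finset.sum_apply, ← hω, hquadrant]

theorem exists_grid_domination (hΛ : IsIndepScattered Λ P) (hmean : IsCentred Λ P)
    (hw : Measurable w) {x : ℝ × ℝ} (hbdd : Bornology.IsBounded (w ⁻¹' Set.Iic x))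
    {ι : Type*} {e : ι → ℝ × ℝ} (he : ∀ i, e i ≤ x) (F : Finset ι) :
    ∃ (ξ : ℕ × ℕ → Ω → ℝ) (s : Finset (ℕ × ℕ)) (m n : ℕ), IsIndepCentred ξ P ∧
      (∀ᵐ ω ∂P, Λ (w ⁻¹' Set.Iic x) ω = gridSum ξ s Prod.fst Prod.snd m n ω) ∧
      ∀ᵐ ω ∂P, ⨆ i ∈ F, ‖Λ (w ⁻¹' Set.Iic (e i)) ω‖ₑ ≤
        ENNReal.ofReal (gridMax ξ s Prod.fst Prod.snd m n ω) := by
  classical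
  let G : Finset (ℝ × ℝ) := insert x (F.image e)
  refine ⟨_, _, _, _, hΛ.isIndepCentred_fibres hmean (measurableSet_Iic.preimage hw) hbdd
    ((measurable_gridRank G).comp hw),
    hΛ.ae_quadrant_eq_gridSum hw hbdd (Finset.mem_insert_self x _) le_rfl, ?_⟩
  have hcorner (i : ι) (hi : i ∈ F) := hΛ.ae_quadrant_eq_gridSum hw hbdd
    (Finset.mem_insert_of_mem (Finset.mem_image_of_mem e hi) : e i ∈ G) (he i)
  filter_upwards [(F.eventually_all).2 hcorner] with ω hω
  refine iSup₂_le fun i hi => ?_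
  rw [hω i hi, Real.enorm_eq_ofReal_abs]
  exact ENNReal.ofReal_le_ofReal (abs_gridSum_le_gridMax _ _ _ _
    (monotone_rank _ (he i).1) (monotone_rank _ (he i).2) ω)

theorem ae_tendsto_quadrant (hΛ : IsIndepScattered Λ P) (hw : Measurable w)
    {y : ℕ → ℝ × ℝ} {x : ℝ × ℝ} (hbdd : Bornology.IsBounded (w ⁻¹' Set.Iic (y 0)))
    (hanti : Antitone y) (hy : Tendsto y atTop (𝓝 x)) :
    ∀ᵐ ω ∂P, Tendsto (fun n => Λ (w ⁻¹' Set.Iic (y n)) ω) atTop (𝓝 (Λ (w ⁻¹' Set.Iic x) ω)) := by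
  have hInter : ⋂ n, w ⁻¹' Set.Iic (y n) = w ⁻¹' Set.Iic x := by
    ext s
    simp only [Set.mem_iInter, Set.mem_preimage, Set.mem_Iic]
    exact ⟨fun h => ge_of_tendsto' hy h, fun h n => h.trans (hanti.le_of_tendsto hy n)⟩
  rw [← hInter]
  exact hΛ.ae_tendsto_iInter (fun n => measurableSet_Iic.preimage hw) hbdd
    fun m n hmn => Set.preimage_mono (Set.Iic_subset_Iic.2 (hanti hmn))

variable [IsProbabilityMeasure P]

theorem mul_measure_lt_biSup_quadrant_le (hΛ : IsIndepScattered Λ P) (hmean : IsCentred Λ P)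
    (hw : Measurable w) {x : ℝ × ℝ} (hbdd : Bornology.IsBounded (w ⁻¹' Set.Iic x))
    {ι : Type*} {e : ι → ℝ × ℝ} (he : ∀ i, e i ≤ x) (F : Finset ι) (t : ℝ≥0∞) :
    t * P {ω | t < ⨆ i ∈ F, ‖Λ (w ⁻¹' Set.Iic (e i)) ω‖ₑ} ≤
      6 * ∫⁻ ω, ‖Λ (w ⁻¹' Set.Iic x) ω‖ₑ ∂P := by
  rcases eq_or_ne t ∞ with rfl | ht
  · simp
  rcases eq_or_ne t 0 with rfl | ht0
  · simp
  obtain ⟨ξ, s, m, n, hξ, hcorner, hmax⟩ := hΛ.exists_grid_domination hmean hw hbdd he F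
  have hincl : P {ω | t < ⨆ i ∈ F, ‖Λ (w ⁻¹' Set.Iic (e i)) ω‖ₑ} ≤
      P {ω | t.toReal ≤ gridMax ξ s Prod.fst Prod.snd m n ω} := by
    refine measure_mono_ae ?_
    filter_upwards [hmax] with ω hω (hlt : t < _)
    exact ENNReal.toReal_le_of_le_ofReal
      (partialSups_nonneg (fun _ => partialSups_nonneg (fun _ _ => abs_nonneg _) n) m ω)
      (hlt.le.trans hω)
  calc t * P {ω | t < ⨆ i ∈ F, ‖Λ (w ⁻¹' Set.Iic (e i)) ω‖ₑ}
      ≤ ENNReal.ofReal t.toReal * P {ω | t.toReal ≤ gridMax ξ s Prod.fst Prod.snd m n ω} := by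
        rw [ENNReal.ofReal_toReal ht]
        gcongr
    _ ≤ 6 * ∫⁻ ω, ENNReal.ofReal |gridSum ξ s Prod.fst Prod.snd m n ω| ∂P :=
        hξ.cairoli_weak_type s _ _ m n (ENNReal.toReal_pos ht0 ht)
    _ = 6 * ∫⁻ ω, ‖Λ (w ⁻¹' Set.Iic x) ω‖ₑ ∂P := by
        congr 1
        refine lintegral_congr_ae ?_
        filter_upwards [hcorner] with ω hω
        rw [hω, Real.enorm_eq_ofReal_abs]

theorem lintegral_biSup_quadrant_rpow_le (hΛ : IsIndepScattered Λ P) (hmean : IsCentred Λ P)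
    (hw : Measurable w) {x : ℝ × ℝ} (hbdd : Bornology.IsBounded (w ⁻¹' Set.Iic x))
    {ι : Type*} {e : ι → ℝ × ℝ} (he : ∀ i, e i ≤ x) (F : Finset ι) {a : ℝ} (ha : 1 < a) :
    ∫⁻ ω, (⨆ i ∈ F, ‖Λ (w ⁻¹' Set.Iic (e i)) ω‖ₑ) ^ a ∂P ≤
      ENNReal.ofReal (a / (a - 1)) ^ (2 * a) * ∫⁻ ω, ‖Λ (w ⁻¹' Set.Iic x) ω‖ₑ ^ a ∂P := by
  obtain ⟨ξ, s, m, n, hξ, hcorner, hmax⟩ := hΛ.exists_grid_domination hmean hw hbdd he F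
  calc ∫⁻ ω, (⨆ i ∈ F, ‖Λ (w ⁻¹' Set.Iic (e i)) ω‖ₑ) ^ a ∂P
      ≤ ∫⁻ ω, ENNReal.ofReal (gridMax ξ s Prod.fst Prod.snd m n ω) ^ a ∂P := by
        refine lintegral_mono_ae ?_
        filter_upwards [hmax] with ω hω
        gcongr
    _ ≤ ENNReal.ofReal (a / (a - 1)) ^ (2 * a) *
          ∫⁻ ω, ENNReal.ofReal |gridSum ξ s Prod.fst Prod.snd m n ω| ^ a ∂P :=
        hξ.cairoli_lintegral_rpow s _ _ m n ha
    _ = ENNReal.ofReal (a / (a - 1)) ^ (2 * a) *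
          ∫⁻ ω, ‖Λ (w ⁻¹' Set.Iic x) ω‖ₑ ^ a ∂P := by
        congr 1
        refine lintegral_congr_ae ?_
        filter_upwards [hcorner] with ω hω
        rw [hω, Real.enorm_eq_ofReal_abs]

theorem mul_measure_le_iSup_quadrant_le (hΛ : IsIndepScattered Λ P) (hmean : IsCentred Λ P)
    (hw : Measurable w) {x : ℝ × ℝ} (hbdd : Bornology.IsBounded (w ⁻¹' Set.Iic x))
    {ι : Type*} [Countable ι] {e : ι → ℝ × ℝ} (he : ∀ i, e i ≤ x) (t : ℝ≥0∞) :
    t * P {ω | t ≤ ⨆ i, ‖Λ (w ⁻¹' Set.Iic (e i)) ω‖ₑ} ≤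
      6 * ∫⁻ ω, ‖Λ (w ⁻¹' Set.Iic x) ω‖ₑ ∂P := by
  refine ENNReal.mul_le_of_forall_lt fun r hr b hb => ?_
  calc r * b ≤ r * P {ω | r < ⨆ i, ‖Λ (w ⁻¹' Set.Iic (e i)) ω‖ₑ} := by
        gcongr
        exact hb.le.trans (measure_mono fun ω => hr.trans_le)
    _ = r * P (⋃ F : Finset ι, {ω | r < ⨆ i ∈ F, ‖Λ (w ⁻¹' Set.Iic (e i)) ω‖ₑ}) := by
        congr 2
        ext ω
        simp only [Set.mem_iUnion, Set.mem_ofPred_eq, ← lt_iSup_iff]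
        rw [iSup_eq_iSup_finset]
    _ = ⨆ F : Finset ι, r * P {ω | r < ⨆ i ∈ F, ‖Λ (w ⁻¹' Set.Iic (e i)) ω‖ₑ} := by
        rw [Directed.measure_iUnion, ENNReal.mul_iSup]
        exact directed_of_isDirected_le fun F G hFG ω (hω : r < _) =>
          hω.trans_le (biSup_mono fun i hi => Finset.mem_of_subset hFG hi)
    _ ≤ _ := iSup_le fun F => hΛ.mul_measure_lt_biSup_quadrant_le hmean hw hbdd he F r

theorem lintegral_iSup_quadrant_rpow_le (hΛ : IsIndepScattered Λ P) (hmean : IsCentred Λ P)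
    (hw : Measurable w) {x : ℝ × ℝ} (hbdd : Bornology.IsBounded (w ⁻¹' Set.Iic x))
    {ι : Type*} [Countable ι] {e : ι → ℝ × ℝ} (he : ∀ i, e i ≤ x) {a : ℝ} (ha : 1 < a) :
    ∫⁻ ω, (⨆ i, ‖Λ (w ⁻¹' Set.Iic (e i)) ω‖ₑ) ^ a ∂P ≤
      ENNReal.ofReal (a / (a - 1)) ^ (2 * a) * ∫⁻ ω, ‖Λ (w ⁻¹' Set.Iic x) ω‖ₑ ^ a ∂P := by
  have ha0 : 0 < a := by linarith
  have hmeas (i : ι) : Measurable (Λ (w ⁻¹' Set.Iic (e i))) :=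
    hΛ.measurable _ (measurableSet_Iic.preimage hw)
      (hbdd.subset (Set.preimage_mono (Set.Iic_subset_Iic.2 (he i))))
  calc ∫⁻ ω, (⨆ i, ‖Λ (w ⁻¹' Set.Iic (e i)) ω‖ₑ) ^ a ∂P
      = ∫⁻ ω, ⨆ F : Finset ι, (⨆ i ∈ F, ‖Λ (w ⁻¹' Set.Iic (e i)) ω‖ₑ) ^ a ∂P := by
        refine lintegral_congr fun ω => ?_
        rw [iSup_eq_iSup_finset]
        exact (ENNReal.orderIsoRpow a ha0).map_iSup _
    _ = ⨆ F : Finset ι, ∫⁻ ω, (⨆ i ∈ F, ‖Λ (w ⁻¹' Set.Iic (e i)) ω‖ₑ) ^ a ∂P := by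
        refine lintegral_iSup_directed (fun F => ?_) (directed_of_isDirected_le fun F G hFG ω => ?_)
        · exact ((Measurable.iSup fun i => .iSup fun _ => (hmeas i).enorm).pow_const a).aemeasurable
        · exact ENNReal.rpow_le_rpow (biSup_mono fun i hi => Finset.mem_of_subset hFG hi) ha0.le
    _ ≤ _ := iSup_le fun F => hΛ.lintegral_biSup_quadrant_rpow_le hmean hw hbdd he F ha

end IsIndepScattered

end Quadrants

section Separability

theorem biSup_enorm_eq_of_forall_mem_closure {T : Type*} {x : T → ℝ} {I D : Set T}
    (hDI : D ⊆ I) (h : ∀ r ∈ I, x r ∈ closure (x '' D)) :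
    ⨆ r ∈ I, ‖x r‖ₑ = ⨆ u ∈ D, ‖x u‖ₑ := by
  refine le_antisymm (iSup₂_le fun r hr => ?_) (biSup_mono hDI)
  have hclosed : IsClosed {z : ℝ | ‖z‖ₑ ≤ ⨆ u ∈ D, ‖x u‖ₑ} :=
    isClosed_le continuous_enorm continuous_const
  refine closure_minimal ?_ hclosed (h r hr)
  rintro _ ⟨u, hu, rfl⟩
  exact le_iSup₂ (f := fun u _ => ‖x u‖ₑ) u hu

variable {Ω T : Type*} [MeasurableSpace Ω] [TopologicalSpace T] {P : Measure Ω}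

theorem exists_mapClusterPt_of_biSup_enorm_ne_top {y : T → ℝ} {D : Set T} {r : T}
    (hr : r ∈ closure D) (hy : ⨆ u ∈ D, ‖y u‖ₑ ≠ ∞) : ∃ z, MapClusterPt z (𝓝[D] r) y := by
  have : (𝓝[D] r).NeBot := mem_closure_iff_nhdsWithin_neBot.1 hr
  have hball (u : T) (hu : u ∈ D) : y u ∈ Metric.closedBall 0 (⨆ u ∈ D, ‖y u‖ₑ).toReal := by
    rw [mem_closedBall_zero_iff, ← toReal_enorm]
    exact ENNReal.toReal_mono hy (le_iSup₂ (f := fun u _ => ‖y u‖ₑ) u hu)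
  obtain ⟨z, -, hz⟩ := (isCompact_closedBall (0 : ℝ) _).exists_mapClusterPt (f := 𝓝[D] r)
    (tendsto_principal.2 (eventually_mem_nhdsWithin.mono hball))
  exact ⟨z, hz⟩

theorem mapClusterPt_nhdsWithin_self {y : T → ℝ} {D : Set T} {r : T} (hr : r ∈ D) :
    MapClusterPt (y r) (𝓝[D] r) y :=
  (tendsto_pure_nhds y r).mapClusterPt.mono (pure_le_nhdsWithin hr)

theorem exists_separable_version {Y : T → Ω → ℝ} {I D : Set T} (hD : D.Countable) (hDI : D ⊆ I)
    (hID : I ⊆ closure D)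
    (hcluster : ∀ r ∈ I, ∀ᵐ ω ∂P, MapClusterPt (Y r ω) (𝓝[D] r) fun u => Y u ω)
    (hbdd : ∀ᵐ ω ∂P, ⨆ u ∈ D, ‖Y u ω‖ₑ ≠ ∞) :
    ∃ X : T → Ω → ℝ, IsVersion X Y P ∧ IsSeparableOn X I P := by
  -- At almost every `ω` the value `Y r ω` is kept; on the exceptional null sets it is replaced by
  -- some cluster point of the values on `D`, chosen separately for each `r`.
  have hvalue (r : T) (ω : Ω) : ∃ z,
      ((r ∈ I → MapClusterPt (Y r ω) (𝓝[D] r) fun u => Y u ω) → z = Y r ω) ∧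
      (r ∈ I → ⨆ u ∈ D, ‖Y u ω‖ₑ ≠ ∞ → MapClusterPt z (𝓝[D] r) fun u => Y u ω) := by
    by_cases h : (r ∈ I → MapClusterPt (Y r ω) (𝓝[D] r) fun u => Y u ω) ∨
      ⨆ u ∈ D, ‖Y u ω‖ₑ = ∞
    · exact ⟨Y r ω, fun _ => rfl, fun hr hfin => h.resolve_right hfin hr⟩
    · push Not at h
      obtain ⟨z, hz⟩ := exists_mapClusterPt_of_biSup_enorm_ne_top (hID h.1.1) h.2
      exact ⟨z, fun hY => absurd (hY h.1.1) h.1.2, fun _ _ => hz⟩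
  choose X hXY hX using hvalue
  have hXD (u : T) (hu : u ∈ D) (ω : Ω) : X u ω = Y u ω :=
    hXY u ω fun _ => mapClusterPt_nhdsWithin_self (y := fun u => Y u ω) hu
  refine ⟨X, fun r => ?_, D, hD, hDI, ?_⟩
  · by_cases hr : r ∈ I
    · filter_upwards [hcluster r hr] with ω hω using hXY r ω fun _ => hω
    · exact Eventually.of_forall fun ω => hXY r ω fun h => absurd h hr
  · filter_upwards [hbdd] with ω hω r hr U hU
    rw [Set.image_congr fun u (hu : u ∈ D ∩ U) => hXD u hu.1 ω]
    exact clusterPt_iff_forall_mem_closure.1 (hX r ω hr hω) _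
      (image_mem_map (inter_mem_nhdsWithin D hU))

theorem exists_countable_biSup_enorm_ae_eq {X Y : T → Ω → ℝ} {I : Set T} (hXY : IsVersion X Y P)
    (hX : IsSeparableOn X I P) :
    ∃ D : Set T, D.Countable ∧ D ⊆ I ∧
      (fun ω => ⨆ r ∈ I, ‖X r ω‖ₑ) =ᵐ[P] fun ω => ⨆ u : D, ‖Y u ω‖ₑ := by
  obtain ⟨D, hD, hDI, hsep⟩ := hX
  refine ⟨D, hD, hDI, ?_⟩
  filter_upwards [hsep, (ae_ball_iff hD).2 fun u _ => hXY u] with ω hω hXYω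
  calc ⨆ r ∈ I, ‖X r ω‖ₑ = ⨆ u ∈ D, ‖X u ω‖ₑ :=
        biSup_enorm_eq_of_forall_mem_closure hDI fun r hr => by
          simpa only [Set.inter_univ] using hω r hr Set.univ univ_mem
    _ = ⨆ u ∈ D, ‖Y u ω‖ₑ := biSup_congr fun u hu => by rw [hXYω u hu]
    _ = ⨆ u : D, ‖Y u ω‖ₑ := iSup_subtype'

end Separability

section LightCoordinates

/-- The characteristic coordinates `(c t + x, c t - x)` of the space-time point `(t, x)`, in which
the order `⪯` is the coordinatewise order. -/
def lightCoord (c : ℝ) (r : ℝ≥0 × ℝ) : ℝ × ℝ :=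
  (c * r.1 + r.2, c * r.1 - r.2)

/-- The space-time point with given characteristic coordinates. The truncation of the time
coordinate at `0` makes this a right inverse of `lightCoord c` only where `0 ≤ y.1 + y.2`. -/
noncomputable def lightPoint (c : ℝ) (y : ℝ × ℝ) : ℝ≥0 × ℝ :=
  (((y.1 + y.2) / (2 * c)).toNNReal, (y.1 - y.2) / 2)

theorem continuous_lightCoord (c : ℝ) : Continuous (lightCoord c) := by
  unfold lightCoord
  fun_prop

theorem continuous_lightPoint (c : ℝ) : Continuous (lightPoint c) := by
  unfold lightPoint
  fun_prop

variable {c : ℝ}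

theorem lightPoint_lightCoord (hc : 0 < c) (r : ℝ≥0 × ℝ) : lightPoint c (lightCoord c r) = r := by
  have htime : (c * r.1 + r.2 + (c * r.1 - r.2)) / (2 * c) = r.1 := by
    field_simp
    ring
  ext
  · simp only [lightPoint, lightCoord, htime, Real.toNNReal_coe]
  · simp only [lightPoint, lightCoord]
    ring

theorem lightCoord_lightPoint (hc : 0 < c) {y : ℝ × ℝ} (hy : 0 ≤ y.1 + y.2) :
    lightCoord c (lightPoint c y) = y := by
  have htime : c * (((y.1 + y.2) / (2 * c)).toNNReal : ℝ) = (y.1 + y.2) / 2 := by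
    rw [Real.coe_toNNReal _ (by positivity)]
    field_simp
  ext <;> simp only [lightCoord, lightPoint, htime] <;> ring

theorem lightCoord_fst_add_snd_nonneg (hc : 0 < c) (r : ℝ≥0 × ℝ) :
    0 ≤ (lightCoord c r).1 + (lightCoord c r).2 := by
  have htime : (lightCoord c r).1 + (lightCoord c r).2 = 2 * c * r.1 := by
    simp only [lightCoord]
    ring
  rw [htime]
  positivity

theorem coneLE_iff (hc : 0 < c) {r s : ℝ≥0 × ℝ} :
    ConeLE c s r ↔ lightCoord c s ≤ lightCoord c r := by
  simp only [ConeLE, lightCoord, Prod.mk_le_mk, abs_le, ← NNReal.coe_le_coe]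
  constructor
  · rintro ⟨-, hleft, hright⟩
    constructor <;> linarith
  · rintro ⟨hright, hleft⟩
    exact ⟨le_of_mul_le_mul_left (by linarith) hc, by linarith, by linarith⟩

theorem backwardCone_eq_preimage (hc : 0 < c) :
    backwardCone c = fun r => lightCoord c ⁻¹' Set.Iic (lightCoord c r) := by
  ext r s
  rw [Set.mem_preimage, Set.mem_Iic, ← coneLE_iff hc, ConeLE, ← NNReal.coe_le_coe, ← sub_nonneg]
  rfl

theorem isBounded_preimage_lightCoord_Iic (hc : 0 < c) (y : ℝ × ℝ) :
    Bornology.IsBounded (lightCoord c ⁻¹' Set.Iic y) := by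
  have hsubset : lightCoord c ⁻¹' Set.Iic y ⊆ lightPoint c '' Set.Icc (-y.2, -y.1) y := by
    intro r hr
    have hsum := lightCoord_fst_add_snd_nonneg hc r
    refine ⟨lightCoord c r, ⟨⟨?_, ?_⟩, hr⟩, lightPoint_lightCoord hc r⟩
    · linarith [hr.2]
    · linarith [hr.1]
  exact ((isCompact_Icc.image (continuous_lightPoint c)).isBounded).subset hsubset

theorem exists_antitone_seq_rat {a b : ℝ} (hab : a ≤ b) :
    ∃ u : ℕ → ℝ, Antitone u ∧ (∀ n, u n ∈ insert b (Set.range ((↑) : ℚ → ℝ)) ∩ Set.Icc a b) ∧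
      Tendsto u atTop (𝓝 a) := by
  obtain ⟨v, hv, hav, hlim⟩ := Real.exists_seq_rat_strictAnti_tendsto a
  refine ⟨fun n => min (v n : ℝ) b, fun m n hmn => min_le_min_right b ?_,
    fun n => ⟨?_, le_min (hav n).le hab, min_le_right _ _⟩, ?_⟩
  · exact_mod_cast hv.antitone hmn
  · rcases min_choice (v n : ℝ) b with h | h
    · exact Or.inr ⟨v n, h.symm⟩
    · exact Or.inl h
  · simpa only [min_eq_left hab] using hlim.min (tendsto_const_nhds (x := b))

theorem exists_countable_subset_coneInterval (hc : 0 < c) (p q : ℝ≥0 × ℝ) :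
    ∃ D : Set (ℝ≥0 × ℝ), D.Countable ∧ D ⊆ coneInterval c p q ∧
      ∀ r ∈ coneInterval c p q, ∃ d : ℕ → ℝ≥0 × ℝ, (∀ n, d n ∈ D) ∧
        Antitone (fun n => lightCoord c (d n)) ∧ Tendsto d atTop (𝓝 r) := by
  let C (b : ℝ) : Set ℝ := insert b (Set.range ((↑) : ℚ → ℝ))
  have hC (b : ℝ) : (C b).Countable := (Set.countable_range _).insert b
  refine ⟨lightPoint c '' (C (lightCoord c q).1 ×ˢ C (lightCoord c q).2) ∩ coneInterval c p q,
    (((hC _).prod (hC _)).image _).mono Set.inter_subset_left, Set.inter_subset_right, ?_⟩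
  rintro r ⟨hpr, hrq⟩
  rw [coneLE_iff hc] at hpr hrq
  obtain ⟨u, hu, huC, hulim⟩ := exists_antitone_seq_rat hrq.1
  obtain ⟨v, hv, hvC, hvlim⟩ := exists_antitone_seq_rat hrq.2
  have hcoord (n : ℕ) : lightCoord c (lightPoint c (u n, v n)) = (u n, v n) :=
    lightCoord_lightPoint hc ((lightCoord_fst_add_snd_nonneg hc r).trans
      (add_le_add (huC n).2.1 (hvC n).2.1))
  refine ⟨fun n => lightPoint c (u n, v n), fun n => ⟨⟨_, ⟨(huC n).1, (hvC n).1⟩, rfl⟩, ?_, ?_⟩,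
    fun m n hmn => ?_, ?_⟩
  · rw [coneLE_iff hc, hcoord]
    exact hpr.trans ⟨(huC n).2.1, (hvC n).2.1⟩
  · rw [coneLE_iff hc, hcoord]
    exact ⟨(huC n).2.2, (hvC n).2.2⟩
  · simp only [hcoord]
    exact ⟨hu hmn, hv hmn⟩
  · rw [← lightPoint_lightCoord hc r]
    exact ((continuous_lightPoint c).tendsto _).comp (hulim.prodMk_nhds hvlim)

end LightCoordinates

section LightCones

variable {Ω : Type*} [MeasurableSpace Ω] {P : Measure Ω} [IsProbabilityMeasure P]
  {Λ : Set (ℝ≥0 × ℝ) → Ω → ℝ} {c : ℝ}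

namespace IsIndepScattered

theorem ae_iSup_backwardCone_ne_top (hΛ : IsIndepScattered Λ P) (hmean : IsCentred Λ P)
    (hc : 0 < c) {q : ℝ≥0 × ℝ} {D : Set (ℝ≥0 × ℝ)} (hD : D.Countable)
    (hDq : ∀ u ∈ D, ConeLE c u q) : ∀ᵐ ω ∂P, ⨆ u ∈ D, ‖Λ (backwardCone c u) ω‖ₑ ≠ ∞ := by
  have := hD.to_subtype
  have hbdd := isBounded_preimage_lightCoord_Iic hc (lightCoord c q)
  have hmeas := (continuous_lightCoord c).measurable
  have hweak := hΛ.mul_measure_le_iSup_quadrant_le hmean hmeas hbdd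
    (fun u : D => (coneLE_iff hc).1 (hDq u u.2)) ∞
  have hfin : 6 * ∫⁻ ω, ‖Λ (lightCoord c ⁻¹' Set.Iic (lightCoord c q)) ω‖ₑ ∂P ≠ ∞ :=
    ENNReal.mul_ne_top (by simp) (hmean _ (measurableSet_Iic.preimage hmeas) hbdd).1.2.ne
  simp only [backwardCone_eq_preimage hc, ae_iff, not_not, iSup_subtype', ← top_le_iff]
  by_contra h
  exact hfin (top_le_iff.1 ((ENNReal.top_mul h).ge.trans hweak))

theorem exists_separable_version_backwardCone (hΛ : IsIndepScattered Λ P) (hmean : IsCentred Λ P)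
    (hc : 0 < c) (p q : ℝ≥0 × ℝ) :
    ∃ X : ℝ≥0 × ℝ → Ω → ℝ, IsVersion X (fun r => Λ (backwardCone c r)) P ∧
      IsSeparableOn X (coneInterval c p q) P := by
  obtain ⟨D, hD, hDI, happrox⟩ := exists_countable_subset_coneInterval hc p q
  refine exists_separable_version hD hDI (fun r hr => ?_) (fun r hr => ?_)
    (hΛ.ae_iSup_backwardCone_ne_top hmean hc hD fun u hu => (hDI hu).2)
  · obtain ⟨d, hdD, -, hlim⟩ := happrox r hr
    exact mem_closure_of_tendsto hlim (Eventually.of_forall hdD)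
  · obtain ⟨d, hdD, hanti, hlim⟩ := happrox r hr
    have hright := hΛ.ae_tendsto_quadrant (continuous_lightCoord c).measurable
      (isBounded_preimage_lightCoord_Iic hc _) hanti
      (((continuous_lightCoord c).tendsto r).comp hlim)
    simp only [backwardCone_eq_preimage hc]
    filter_upwards [hright] with ω hω
    exact .of_comp (tendsto_nhdsWithin_iff.2 ⟨hlim, Eventually.of_forall hdD⟩) hω.mapClusterPt

end IsIndepScattered

theorem lemma6p2_general (hΛ : IsIndepScattered Λ P) (hmean : IsCentred Λ P) (hc : 0 < c)
    (p q : ℝ≥0 × ℝ) :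
    (∃ X : ℝ≥0 × ℝ → Ω → ℝ, IsVersion X (fun r => Λ (backwardCone c r)) P ∧
      IsSeparableOn X (coneInterval c p q) P) ∧
    ∀ X : ℝ≥0 × ℝ → Ω → ℝ, IsVersion X (fun r => Λ (backwardCone c r)) P →
      IsSeparableOn X (coneInterval c p q) P →
      AEMeasurable (fun ω => ⨆ r ∈ coneInterval c p q, ‖X r ω‖ₑ) P ∧
      (∀ l : ℝ≥0∞, l * P {ω | l ≤ ⨆ r ∈ coneInterval c p q, ‖X r ω‖ₑ} ≤
        6 * ∫⁻ ω, ‖X q ω‖ₑ ∂P) ∧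
      ∀ a : ℝ, 1 < a → ∫⁻ ω, (⨆ r ∈ coneInterval c p q, ‖X r ω‖ₑ ^ a) ∂P ≤
        ENNReal.ofReal ((a / (a - 1)) ^ (2 * a)) * ∫⁻ ω, ‖X q ω‖ₑ ^ a ∂P := by
  refine ⟨hΛ.exists_separable_version_backwardCone hmean hc p q, fun X hX hsep => ?_⟩
  obtain ⟨D, hD, hDI, hsup⟩ := exists_countable_biSup_enorm_ae_eq hX hsep
  have := hD.to_subtype
  have hmeas := (continuous_lightCoord c).measurable
  have hbdd := isBounded_preimage_lightCoord_Iic hc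
  have hDq (u : D) : lightCoord c u ≤ lightCoord c q := (coneLE_iff hc).1 (hDI u.2).2
  have hq (g : ℝ → ℝ≥0∞) : ∫⁻ ω, g (X q ω) ∂P = ∫⁻ ω, g (Λ (backwardCone c q) ω) ∂P :=
    lintegral_congr_ae ((hX q).fun_comp g)
  simp only [backwardCone_eq_preimage hc] at hsup hq
  refine ⟨?_, fun l => ?_, fun a ha => ?_⟩
  · exact (Measurable.iSup fun u : D => (hΛ.measurable _
      (measurableSet_Iic.preimage hmeas) (hbdd _)).enorm).aemeasurable.congr hsup.symm
  · have hset : {ω | l ≤ ⨆ r ∈ coneInterval c p q, ‖X r ω‖ₑ} =ᵐ[P]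
        {ω | l ≤ ⨆ u : D, ‖Λ (lightCoord c ⁻¹' Set.Iic (lightCoord c u)) ω‖ₑ} :=
      hsup.fun_comp (l ≤ ·)
    rw [hq, measure_congr hset]
    exact hΛ.mul_measure_le_iSup_quadrant_le hmean hmeas (hbdd _) hDq l
  · have ha0 : 0 < a := by linarith
    have hsup_pow := lintegral_congr_ae (hsup.fun_comp (· ^ a))
    simp only [Function.comp_def] at hsup_pow
    have hpow (ω : Ω) : ⨆ r ∈ coneInterval c p q, ‖X r ω‖ₑ ^ a =
        (⨆ r ∈ coneInterval c p q, ‖X r ω‖ₑ) ^ a :=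
      ((ENNReal.orderIsoRpow a ha0).map_iSup₂ fun r (_ : r ∈ coneInterval c p q) => ‖X r ω‖ₑ).symm
    rw [hq (‖·‖ₑ ^ a), lintegral_congr hpow, hsup_pow,
      ← ENNReal.ofReal_rpow_of_nonneg (by positivity) (by positivity)]
    exact hΛ.lintegral_iSup_quadrant_rpow_le hmean hmeas (hbdd _) hDq ha

end LightCones

theorem lemma6p2 {Ω : Type*} [MeasurableSpace Ω] (P : Measure Ω) [IsProbabilityMeasure P]
    (Λ : Set (ℝ≥0 × ℝ) → Ω → ℝ) (hΛ : IsLevyBasis Λ P) (hmean : HasMeanZero Λ P)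
    (c : ℝ) (hc : 0 < c) (p q : ℝ≥0 × ℝ) (hpq : ConeLE c p q) :
    (∃ X : ℝ≥0 × ℝ → Ω → ℝ, IsVersion X (fun r => Λ (backwardCone c r)) P ∧
      IsSeparableOn X (coneInterval c p q) P) ∧
    ∀ X : ℝ≥0 × ℝ → Ω → ℝ, IsVersion X (fun r => Λ (backwardCone c r)) P →
      IsSeparableOn X (coneInterval c p q) P →
      AEMeasurable (fun ω => ⨆ r ∈ coneInterval c p q, ‖X r ω‖ₑ) P ∧
      (∀ l : ℝ, 0 < l →
        ENNReal.ofReal l * P {ω | ENNReal.ofReal l ≤ ⨆ r ∈ coneInterval c p q, ‖X r ω‖ₑ} ≤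
          13 * ∫⁻ ω, ‖X q ω‖ₑ ∂P) ∧
      (∀ a : ℝ, 1 < a → HasFiniteMoment Λ P a →
        ∫⁻ ω, (⨆ r ∈ coneInterval c p q, ‖X r ω‖ₑ ^ a) ∂P ≤
          ENNReal.ofReal ((a / (a - 1)) ^ (2 * a)) * ∫⁻ ω, ‖X q ω‖ₑ ^ a ∂P) := by
  obtain ⟨hexists, hmaximal⟩ := lemma6p2_general
    ⟨hΛ.measurable, hΛ.indep, hΛ.sigma_additive⟩ hmean hc p q
  refine ⟨hexists, fun X hX hsep => ?_⟩
  obtain ⟨hmeas, hweak, hstrong⟩ := hmaximal X hX hsep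
  exact ⟨hmeas, fun l _ => (hweak _).trans (by gcongr; norm_num), fun a ha _ => hstrong a ha⟩
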